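/- Let $\mathcal H$ be a separable complex Hilbert space and let $\mathcal F_R^{sa}$ be the set of densely defined, closed, self-adjoint operators $T$ in $\mathcal H$ such that $(I+T^2)^{-1}$ is compact and $T$ has infinitely many positive and infinitely many negative eigenvalues. Let $X$ be a compact simplicial complex and let $D=\{D_x\}_{x\in X}$ be a family of operators in $\mathcal F_R^{sa}$ which is continuous in the sense that $(f,x)\mapsto f(D_x)$ is continuous from $C_b(\mathbb R)\times X$ to $\mathcal B(\mathcal H)$ with the norm topology, where $C_b(\mathbb R)$ is the space, with the supremum norm, of bounded continuous functions $\mathbb R\to\mathbb C$ that have limits at $+\infty$ and at $-\infty$. A spectral exhaustion of a family $\{D_y\}_{y\in Y}$ is a family of continuous functions $\mu_n:Y\to\mathbb R$, $n\in\mathbb Z$, such that, for all $y\in Y$: each $\mu_n(y)$ is an eigenvalue of $D_y$; each eigenvalue $\lambda$ of $D_y$ equals $\mu_n(y)$ for exactly $\dim\ker(D_y-\lambda)$ indices $n$; and $\mu_n(y)\le\mu_{n+1}(y)$ for all $n$. Consider an open cover $\{V_i\}_{i\in X}$ of $X$, indexed by the points of $X$ with $i\in V_i$ for all $i$, spectral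 exhaustions $\{\mu_{n,i}\}_n$ of the restrictions of $D$ to the sets $V_i$, and a Čech $1$-cocycle $\nu$ of locally constant functions $\nu_{ij}:V_i\cap V_j\to\mathbb Z$ such that $\mu_{n,i}=\mu_{n+\nu_{ij},j}$ on $V_i\cap V_j$ for all $n$. Then such data exist, and the class of $\nu$ in the Čech cohomology group $\check H^1(X;\mathbb Z)$ does not depend on their choice; it is called the spectral flow $\mathrm{sf}(D)$. Moreover, $D$ has a spectral exhaustion on all of $X$ if and only if $\mathrm{sf}(D)=0$. -/

import Mathlib

open Filter Topology TopologicalSpace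
open scoped BoundedContinuousFunction

/-! ### Unbounded operators: eigenspaces, multiplicities and the class `FRsa` -/

namespace SpecFlow

section Operators

variable {H : Type*} [NormedAddCommGroup H] [InnerProductSpace ℂ H]

/-- The eigenspace `ker (T - c)`: the vectors `v` of the domain of `T` with `T v = c v`. -/
def eigenspace (T : H →ₗ.[ℂ] H) (c : ℝ) : Submodule ℂ H :=
  T.graph.comap (LinearMap.id.prod ((c : ℂ) • LinearMap.id))

theorem mem_eigenspace {T : H →ₗ.[ℂ] H} {c : ℝ} {v : H} :
    v ∈ eigenspace T c ↔ ∃ h : v ∈ T.domain, T ⟨v, h⟩ = (c : ℂ) • v := by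
  change (v, (c : ℂ) • v) ∈ T.graph ↔ _
  simp only [LinearPMap.mem_graph_iff]
  constructor
  · rintro ⟨y, rfl, h⟩
    exact ⟨y.2, h⟩
  · rintro ⟨h, h'⟩
    exact ⟨⟨v, h⟩, rfl, h'⟩

/-- `c` is an eigenvalue of `T` (the eigenvalues of a self-adjoint operator are real). -/
def IsEigenvalue (T : H →ₗ.[ℂ] H) (c : ℝ) : Prop :=
  eigenspace T c ≠ ⊥

/-- The multiplicity of `c` as an eigenvalue of `T`. It is `0` if `c` is not an eigenvalue.
(The operators considered below have finite-dimensional eigenspaces.) -/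
noncomputable def multiplicity (T : H →ₗ.[ℂ] H) (c : ℝ) : ℕ :=
  Module.finrank ℂ (eigenspace T c)

/-- The bounded operator `R` is the inverse of `I + T ^ 2`, where the domain of `T ^ 2` consists of
the `v` in the domain of `T` such that `T v` is in the domain of `T` as well: `R u = v` if and only
if `v` is in the domain of `T ^ 2` and `v + T (T v) = u`. -/
def IsInverseOneAddSq (T : H →ₗ.[ℂ] H) (R : H →L[ℂ] H) : Prop :=
  ∀ u v : H, R u = v ↔
    ∃ (h : v ∈ T.domain) (h' : T ⟨v, h⟩ ∈ T.domain), v + T ⟨T ⟨v, h⟩, h'⟩ = u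

variable [CompleteSpace H]

variable (H) in
/-- The regular unbounded self-adjoint Fredholm operators in the Hilbert space `H`. -/
structure FRsa where
  /-- the operator, defined on a subspace of `H` -/
  op : H →ₗ.[ℂ] H
  dense_domain : Dense (op.domain : Set H)
  closed : op.IsClosed
  selfAdjoint : IsSelfAdjoint op
  compact_resolvent : ∃ R : H →L[ℂ] H, IsInverseOneAddSq op R ∧ IsCompactOperator R
  infinite_pos : {c : ℝ | 0 < c ∧ IsEigenvalue op c}.Infinite
  infinite_neg : {c : ℝ | c < 0 ∧ IsEigenvalue op c}.Infinite

theorem isClosed_eigenspace (T : FRsa H) (c : ℝ) :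
    IsClosed (eigenspace T.op c : Set H) := by
  have h : Continuous fun v : H => (v, (c : ℂ) • v) := by fun_prop
  exact T.closed.preimage h

instance (T : FRsa H) (c : ℝ) : (eigenspace T.op c).HasOrthogonalProjection :=
  haveI : CompleteSpace (eigenspace T.op c) := (isClosed_eigenspace T c).completeSpace_coe
  inferInstance

theorem orthogonalFamily_eigenspace (T : FRsa H) :
    OrthogonalFamily ℂ (fun c : ℝ => eigenspace T.op c)
      (fun c => (eigenspace T.op c).subtypeₗᵢ) := by
  intro a b hab v w
  obtain ⟨hv, hv'⟩ := mem_eigenspace.1 v.2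
  obtain ⟨hw, hw'⟩ := mem_eigenspace.1 w.2
  have hs := LinearPMap.adjoint_isFormalAdjoint T.dense_domain
  rw [LinearPMap.isSelfAdjoint_def.1 T.selfAdjoint] at hs
  have := hs ⟨v, hv⟩ ⟨w, hw⟩
  rw [hv', hw', inner_smul_left, inner_smul_right, Complex.conj_ofReal] at this
  have h2 : ((a : ℂ) - b) * inner ℂ (v : H) (w : H) = 0 := by
    linear_combination this
  rcases mul_eq_zero.1 h2 with h | h
  · exact absurd (by exact_mod_cast sub_eq_zero.1 h) hab
  · exact h

/-! ### The functional calculus -/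

theorem sum_norm_sq_proj_le (T : FRsa H) (s : Finset ℝ) (v : H) :
    ∑ c ∈ s, ‖(eigenspace T.op c).starProjection v‖ ^ 2 ≤ ‖v‖ ^ 2 := by
  set w : H := ∑ c ∈ s, (eigenspace T.op c).starProjection v with hw
  have h1 : ‖w‖ ^ 2 = ∑ c ∈ s, ‖(eigenspace T.op c).starProjection v‖ ^ 2 :=
    (orthogonalFamily_eigenspace T).norm_sum
      (fun c => (eigenspace T.op c).orthogonalProjectionOnto v) s
  have h2 : inner ℂ w v = ((‖w‖ ^ 2 : ℝ) : ℂ) := by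
    rw [h1, hw, sum_inner, Complex.ofReal_sum]
    refine Finset.sum_congr rfl fun c _ => ?_
    have h3 : inner ℂ ((eigenspace T.op c).starProjection v)
        (v - (eigenspace T.op c).starProjection v) = 0 :=
      (Submodule.mem_orthogonal _ _).1
        ((eigenspace T.op c).sub_starProjection_mem_orthogonal v) _
        (Submodule.starProjection_apply_mem _ v)
    rw [inner_sub_right, sub_eq_zero, inner_self_eq_norm_sq_to_K] at h3
    rw [h3]
    norm_cast
  have h4 : ‖w‖ ^ 2 ≤ ‖w‖ * ‖v‖ := by
    have := norm_inner_le_norm (𝕜 := ℂ) w v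
    rw [h2, Complex.norm_real, Real.norm_of_nonneg (by positivity)] at this
    exact this
  rw [← h1]
  have h5 : ‖w‖ ≤ ‖v‖ := by
    by_contra! h
    nlinarith [norm_nonneg v]
  gcongr

theorem norm_sum_le (T : FRsa H) (f : ℝ →ᵇ ℂ) (s : Finset ℝ) (v : H) :
    ‖∑ c ∈ s, f c • (eigenspace T.op c).starProjection v‖ ≤ ‖f‖ * ‖v‖ ∧
      ∑ c ∈ s, ‖f c • (eigenspace T.op c).starProjection v‖ ^ 2 ≤ (‖f‖ * ‖v‖) ^ 2 := by
  have h1 : ‖∑ c ∈ s, f c • (eigenspace T.op c).starProjection v‖ ^ 2 =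
      ∑ c ∈ s, ‖f c • (eigenspace T.op c).starProjection v‖ ^ 2 :=
    (orthogonalFamily_eigenspace T).norm_sum
      (fun c => f c • (eigenspace T.op c).orthogonalProjectionOnto v) s
  have h2 : ∑ c ∈ s, ‖f c • (eigenspace T.op c).starProjection v‖ ^ 2 ≤ (‖f‖ * ‖v‖) ^ 2 :=
    calc _ ≤ ∑ c ∈ s, ‖f‖ ^ 2 * ‖(eigenspace T.op c).starProjection v‖ ^ 2 := by
          refine Finset.sum_le_sum fun c _ => ?_
          rw [norm_smul, mul_pow]
          gcongr
          exact f.norm_coe_le_norm c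
      _ = ‖f‖ ^ 2 * ∑ c ∈ s, ‖(eigenspace T.op c).starProjection v‖ ^ 2 := by
          rw [Finset.mul_sum]
      _ ≤ _ := by
          rw [mul_pow]
          gcongr
          exact sum_norm_sq_proj_le T s v
  refine ⟨?_, h2⟩
  rw [← h1] at h2
  exact le_of_sq_le_sq h2 (by positivity)

theorem summable_calculus (T : FRsa H) (f : ℝ →ᵇ ℂ) (v : H) :
    Summable fun c : ℝ => f c • (eigenspace T.op c).starProjection v := by
  refine ((orthogonalFamily_eigenspace T).summable_iff_norm_sq_summable
    (fun c => f c • (eigenspace T.op c).orthogonalProjectionOnto v)).2 ?_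
  exact summable_of_sum_le (fun _ => by positivity) fun s => (norm_sum_le T f s v).2

/-- The functional calculus `f(T)`, by the spectral decomposition of `T`:
`f(T) v = ∑ f(c) P_c v`, where `c` runs over the eigenvalues of `T` (for the other `c` the summand
vanishes) and `P_c` is the orthogonal projection onto the eigenspace of `c`. The eigenspaces span a
dense subspace, because `(I + T ^ 2)⁻¹` is compact. -/
noncomputable def calculus (T : FRsa H) (f : ℝ →ᵇ ℂ) : H →L[ℂ] H :=
  LinearMap.mkContinuous
    { toFun := fun v => ∑' c : ℝ, f c • (eigenspace T.op c).starProjection v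
      map_add' := fun v w => by
        rw [← (summable_calculus T f v).tsum_add (summable_calculus T f w)]
        simp only [map_add, smul_add]
      map_smul' := fun a v => by
        rw [RingHom.id_apply, ← (summable_calculus T f v).tsum_const_smul]
        simp only [map_smul, smul_comm a] }
    ‖f‖ fun v => le_of_tendsto (summable_calculus T f v).hasSum.norm
      (Eventually.of_forall fun s => (norm_sum_le T f s v).1)

/-- The bounded continuous functions on `ℝ` which have limits at `+∞` and at `-∞`, with the
topology of the supremum norm. -/
def Cb : Set (ℝ →ᵇ ℂ) :=
  {f | (∃ a, Tendsto f atTop (𝓝 a)) ∧ ∃ b, Tendsto f atBot (𝓝 b)}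

/-- Continuity of a family of operators: `(f, x) ↦ f(D_x)` is continuous, as a map from `Cb × X`
to the bounded operators with the norm topology. -/
def IsContinuousFamily {X : Type*} [TopologicalSpace X] (D : X → FRsa H) : Prop :=
  Continuous fun p : Cb × X => calculus (D p.2) (p.1 : ℝ →ᵇ ℂ)

/-! ### Spectral exhaustions -/

/-- A spectral exhaustion for the family `D`. The spectrum of `D x` consists of its eigenvalues. -/
structure IsSpectralExhaustion {X : Type*} [TopologicalSpace X] (D : X → FRsa H)
    (μ : ℤ → X → ℝ) : Prop where
  continuous : ∀ n, Continuous (μ n)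
  isEigenvalue : ∀ n x, IsEigenvalue (D x).op (μ n x)
  exhausts : ∀ x, ∀ c : ℝ, IsEigenvalue (D x).op c →
    {n : ℤ | μ n x = c}.encard = multiplicity (D x).op c
  mono : ∀ n x, μ n x ≤ μ (n + 1) x

end Operators

/-! ### Čech cohomology in degree one with integer coefficients -/

section Cech

variable {X : Type*} [TopologicalSpace X]

variable (X) in
/-- An open cover of `X`, indexed by the points of `X` such that each point is in the open set with
this index. Every open cover has a refinement of this kind. -/
structure PointedCover where
  /-- the open set with index `x` -/
  nhd : X → Opens X
  mem_nhd : ∀ x, x ∈ nhd x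

/-- Covers are ordered by refinement: `U ≤ V` if `V` is finer than `U`. -/
instance : Preorder (PointedCover X) where
  le U V := ∀ x, V.nhd x ≤ U.nhd x
  le_refl _ _ := le_rfl
  le_trans _ _ _ h h' x := (h' x).trans (h x)

instance : Nonempty (PointedCover X) := ⟨⟨fun _ => ⊤, fun _ => trivial⟩⟩

instance : IsDirectedOrder (PointedCover X) :=
  ⟨fun U V => ⟨⟨fun x => U.nhd x ⊓ V.nhd x, fun x => ⟨U.mem_nhd x, V.mem_nhd x⟩⟩,
    fun _ => inf_le_left, fun _ => inf_le_right⟩⟩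

/-- Restriction of locally constant integer-valued functions, which are the sections of the
constant sheaf with fibre `ℤ`. -/
def res {V W : Opens X} (h : V ≤ W) : LocallyConstant W ℤ →+ LocallyConstant V ℤ :=
  LocallyConstant.comapAddMonoidHom ⟨Set.inclusion h, continuous_inclusion h⟩

namespace PointedCover

/-- Čech cochains of degree `0`. -/
abbrev C0 (U : PointedCover X) : Type _ :=
  ∀ x, LocallyConstant (U.nhd x) ℤ

/-- Čech cochains of degree `1`. -/
abbrev C1 (U : PointedCover X) : Type _ :=
  ∀ x y, LocallyConstant (U.nhd x ⊓ U.nhd y : Opens X) ℤ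

/-- Čech cochains of degree `2`. -/
abbrev C2 (U : PointedCover X) : Type _ :=
  ∀ x y z, LocallyConstant (U.nhd x ⊓ U.nhd y ⊓ U.nhd z : Opens X) ℤ

/-- `(d0 σ)_{xy} = σ_y - σ_x`. -/
def d0 (U : PointedCover X) : U.C0 →+ U.C1 where
  toFun σ x y := res inf_le_right (σ y) - res inf_le_left (σ x)
  map_zero' := by
    funext x y
    simp
  map_add' σ τ := by
    funext x y
    simp only [Pi.add_apply, map_add]
    abel

/-- `(d1 ν)_{xyz} = ν_{yz} - ν_{xz} + ν_{xy}`. -/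
def d1 (U : PointedCover X) : U.C1 →+ U.C2 where
  toFun ν x y z :=
    res (le_inf (inf_le_left.trans inf_le_right) inf_le_right) (ν y z)
      - res (le_inf (inf_le_left.trans inf_le_left) inf_le_right) (ν x z)
      + res inf_le_left (ν x y)
  map_zero' := by
    funext x y z
    simp
  map_add' ν κ := by
    funext x y z
    simp only [Pi.add_apply, map_add]
    abel

theorem d1_d0 (U : PointedCover X) (σ : U.C0) : U.d1 (U.d0 σ) = 0 := by
  funext x y z
  ext p
  change (σ z ⟨p, p.2.2⟩ - σ y ⟨p, p.2.1.2⟩) - (σ z ⟨p, p.2.2⟩ - σ x ⟨p, p.2.1.1⟩) +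
    (σ y ⟨p, p.2.1.2⟩ - σ x ⟨p, p.2.1.1⟩) = 0
  abel

/-- Čech cocycles of degree `1`. -/
abbrev Z1 (U : PointedCover X) : AddSubgroup U.C1 := U.d1.ker

/-- The first Čech cohomology group of the cover `U`. -/
abbrev H1 (U : PointedCover X) : Type _ :=
  U.Z1 ⧸ U.d0.range.addSubgroupOf U.Z1

/-- Restriction of cocycles to a refinement. -/
def resZ1 {U V : PointedCover X} (h : U ≤ V) : U.Z1 →+ V.Z1 where
  toFun ν := ⟨fun x y => res (inf_le_inf (h x) (h y)) (ν.1 x y), by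
    rw [AddMonoidHom.mem_ker]
    funext x y z
    ext p
    have := DFunLike.congr_fun (congrFun (congrFun (congrFun ν.2 x) y) z)
      (Set.inclusion (inf_le_inf (inf_le_inf (h x) (h y)) (h z)) p)
    exact this⟩
  map_zero' := rfl
  map_add' _ _ := rfl

/-- The map induced on the first cohomology groups by a refinement. -/
def resH1 (U V : PointedCover X) (h : U ≤ V) : U.H1 →+ V.H1 :=
  QuotientAddGroup.map _ _ (resZ1 h) <| by
    rintro ν ⟨σ, hσ⟩
    refine ⟨fun x => res (h x) (σ x), ?_⟩
    funext x y
    ext p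
    exact DFunLike.congr_fun (congrFun (congrFun hσ x) y) (Set.inclusion (inf_le_inf (h x) (h y)) p)

instance : DirectedSystem (fun U : PointedCover X => U.H1) (fun U V h => resH1 U V h) where
  map_self _ z := by
    obtain ⟨ν, rfl⟩ := QuotientAddGroup.mk_surjective z
    rfl
  map_map _ _ _ _ _ z := by
    obtain ⟨ν, rfl⟩ := QuotientAddGroup.mk_surjective z
    rfl

end PointedCover

open scoped Classical in
variable (X) in
/-- The first Čech cohomology group of `X` with integer coefficients: the direct limit over all
open covers. -/
abbrev CechH1 : Type _ :=
  AddCommGroup.DirectLimit (fun U : PointedCover X => U.H1) PointedCover.resH1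

open scoped Classical in
/-- The class in `CechH1 X` of a cocycle relative to the cover `U`. -/
noncomputable def cechClass (U : PointedCover X) (ν : U.Z1) : CechH1 X :=
  AddCommGroup.DirectLimit.of (fun U : PointedCover X => U.H1) PointedCover.resH1 U
    (QuotientAddGroup.mk ν)

end Cech

/-! ### Spectral flow -/

section SpectralFlow

variable {H : Type*} [NormedAddCommGroup H] [InnerProductSpace ℂ H] [CompleteSpace H]
variable {X : Type*} [TopologicalSpace X]

/-- The class `a` is obtained from locally defined exhaustions: there are an open cover `U`, a
spectral exhaustion `μ x` of the restriction of `D` to each set `U x` of the cover, and a cocycle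
`ν` whose value `ν x y` at a point of `U x ∩ U y` is the integer by which `μ x` and `μ y` differ
there (the position in `μ y` of the eigenvalue with number `0` in `μ x`), such that `a` is the class
of `ν`. -/
def IsSpectralFlow (D : X → FRsa H) (a : CechH1 X) : Prop :=
  ∃ (U : PointedCover X) (μ : ∀ x, ℤ → U.nhd x → ℝ) (ν : U.Z1),
    (∀ x, IsSpectralExhaustion (fun p : U.nhd x => D p) (μ x)) ∧
    (∀ x y, ∀ p : (U.nhd x ⊓ U.nhd y : Opens X), ∀ n : ℤ,
      μ x n ⟨p, p.2.1⟩ = μ y (n + ν.1 x y p) ⟨p, p.2.2⟩) ∧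
    cechClass U ν = a

open scoped Classical in
/-- The spectral flow of the family `D`: the class obtained from locally defined exhaustions.
(The value `0` is used if there is no such class, which does not happen for continuous families.) -/
noncomputable def spectralFlow (D : X → FRsa H) : CechH1 X :=
  if h : ∃ a, IsSpectralFlow D a then h.choose else 0

end SpectralFlow

/-- `X` is a compact simplicial complex: it is homeomorphic to the underlying space of a finite
geometric simplicial complex in some Euclidean space. -/
def IsCompactSimplicialComplex (X : Type*) [TopologicalSpace X] : Prop :=
  ∃ (N : ℕ) (K : Geometry.SimplicialComplex ℝ (EuclideanSpace ℝ (Fin N))),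
    K.faces.Finite ∧ Nonempty (X ≃ₜ K.space)

end SpecFlow

/-! Compactness of `(I + T²)⁻¹` makes the spectrum discrete with finite multiplicities, so the
eigenvalues in `[a, b)` can be counted. If `a` and `b` are not eigenvalues of `D x`, this number is
locally constant near `x`: a bump function `f` equal to `1` on `[a, b)` and to `0` on the rest of
the spectrum turns `f(D x)` into a spectral projection, and projections at distance less than `1`
have equal rank (`IsContinuousFamily.eventually_rankIco_eq`).

As long as `a` avoids the spectrum, numbering the eigenvalues upwards from `a` is therefore a
spectral exhaustion with continuous members
(`IsContinuousFamily.isSpectralExhaustion_nthEigenvalue`). Each point has such an `a`, and the same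
`a` works nearby, which gives local exhaustions.

Two exhaustions of one family list the same multiset in increasing order, so they differ by a unique
shift of the index, and the shift is locally constant
(`IsSpectralExhaustion.exists_locallyConstant_shift`). Uniqueness yields the cocycle identity.
Comparing two choices of data on a common refinement gives a 0-cochain whose coboundary is the
difference of the two cocycles, so the class is well defined.

A global exhaustion has cocycle `0`. Conversely, if the class vanishes, the cocycle is a coboundary
`d0 σ` on some refinement, and renumbering the local exhaustions by `σ` makes them agree on overlaps
and glue. -/

namespace SpecFlow

/-! ### Finite-dimensional spectral subspaces and discreteness of the spectrum -/

section SpectralSubspaces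

variable {H : Type*} [NormedAddCommGroup H] [InnerProductSpace ℂ H]

/-- The algebraic span of the eigenspaces of `T` for eigenvalues in `s`. -/
def spectralSpan (T : H →ₗ.[ℂ] H) (s : Set ℝ) : Submodule ℂ H :=
  ⨆ c ∈ s, eigenspace T c

theorem eigenspace_le_spectralSpan (T : H →ₗ.[ℂ] H) {s : Set ℝ} {c : ℝ} (hc : c ∈ s) :
    eigenspace T c ≤ spectralSpan T s :=
  le_iSup₂_of_le c hc le_rfl

theorem resolvent_apply_of_mem_eigenspace {T : H →ₗ.[ℂ] H} {R : H →L[ℂ] H}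
    (hR : IsInverseOneAddSq T R) {c : ℝ} {v : H} (hv : v ∈ eigenspace T c) :
    R ((1 + (c : ℂ) ^ 2) • v) = v := by
  obtain ⟨h, h'⟩ := mem_eigenspace.1 hv
  have h2 : T ⟨v, h⟩ ∈ T.domain := h' ▸ T.domain.smul_mem _ h
  refine (hR _ _).2 ⟨h, h2, ?_⟩
  have h3 : (⟨T ⟨v, h⟩, h2⟩ : T.domain) = (c : ℂ) • ⟨v, h⟩ := Subtype.ext h'
  rw [h3, LinearPMap.map_smul, h', smul_smul, add_smul, one_smul, sq]

/-- By Riesz, an infinite-dimensional `S` contains a bounded sequence with mutual distances at least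
`1`. As `K` fixes it, compactness would give a convergent subsequence. -/
theorem finiteDimensional_of_isCompactOperator_eq_self (K : H →L[ℂ] H)
    (hK : IsCompactOperator K) (S : Submodule ℂ H) (hS : ∀ v ∈ S, K v = v) :
    FiniteDimensional ℂ S := by
  by_contra hfin
  obtain ⟨r, f, -, hr, hf⟩ := exists_seq_norm_le_one_le_norm_sub (𝕜 := ℂ) (E := S) hfin
  have hc := hK.isCompact_closure_image_closedBall (𝕜₁ := ℂ) r
  have hmem : ∀ n, (f n : H) ∈ closure (K '' Metric.closedBall 0 r) := fun n =>
    subset_closure ⟨f n, by simpa using hr n, hS _ (f n).2⟩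
  obtain ⟨a, -, φ, hφ, ha⟩ := hc.tendsto_subseq hmem
  obtain ⟨N, hN⟩ := Metric.cauchySeq_iff.1 ha.cauchySeq 1 one_pos
  have h1 := hN N le_rfl (N + 1) (by omega)
  have h2 : (1 : ℝ) ≤ ‖f (φ N) - f (φ (N + 1))‖ := hf (hφ (Nat.lt_succ_self N)).ne
  rw [dist_eq_norm] at h1
  exact absurd h1 (not_lt.2 h2)

variable [CompleteSpace H]

theorem calculus_apply (T : FRsa H) (f : ℝ →ᵇ ℂ) (v : H) :
    calculus T f v = ∑' c : ℝ, f c • (eigenspace T.op c).starProjection v := rfl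

theorem calculus_apply_of_mem_eigenspace (T : FRsa H) (f : ℝ →ᵇ ℂ) {c : ℝ} {v : H}
    (hv : v ∈ eigenspace T.op c) : calculus T f v = f c • v := by
  rw [calculus_apply, tsum_eq_single c, Submodule.starProjection_eq_self_iff.2 hv]
  intro b hb
  have h : v ∈ (eigenspace T.op b)ᗮ := by
    rw [Submodule.mem_orthogonal]
    intro u hu
    exact orthogonalFamily_eigenspace T hb ⟨u, hu⟩ ⟨v, hv⟩
  rw [(Submodule.starProjection_apply_eq_zero_iff _).2 h, smul_zero]

theorem norm_apply_le_norm_calculus (T : FRsa H) (f : ℝ →ᵇ ℂ) {c : ℝ}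
    (hc : IsEigenvalue T.op c) : ‖f c‖ ≤ ‖calculus T f‖ := by
  obtain ⟨v, hv, hv0⟩ := Submodule.exists_mem_ne_zero_of_ne_bot hc
  have h := (calculus T f).le_opNorm v
  rw [calculus_apply_of_mem_eigenspace T f hv, norm_smul] at h
  exact le_of_mul_le_mul_right h (norm_pos_iff.2 hv0)

theorem calculus_apply_of_mem_spectralSpan (T : FRsa H) (f : ℝ →ᵇ ℂ) {s : Set ℝ}
    (hf : ∀ c ∈ s, f c = 1) {v : H} (hv : v ∈ spectralSpan T.op s) : calculus T f v = v := by
  have h : spectralSpan T.op s ≤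
      LinearMap.eqLocus (calculus T f : H →ₗ[ℂ] H) LinearMap.id := by
    refine iSup₂_le fun c hc u hu => ?_
    have := calculus_apply_of_mem_eigenspace T f hu
    rw [hf c hc, one_smul] at this
    exact this
  exact h hv

/-- The partial sums of the series lie in the span; finite dimension makes the span closed, so it
contains the limit. -/
theorem calculus_mem_spectralSpan (T : FRsa H) (f : ℝ →ᵇ ℂ) {s : Set ℝ}
    [FiniteDimensional ℂ (spectralSpan T.op s)]
    (hf : ∀ c, IsEigenvalue T.op c → c ∉ s → f c = 0) (v : H) :
    calculus T f v ∈ spectralSpan T.op s := by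
  have hcl : IsClosed (spectralSpan T.op s : Set H) := Submodule.closed_of_finiteDimensional _
  refine hcl.mem_of_tendsto (summable_calculus T f v).hasSum (Eventually.of_forall fun t => ?_)
  refine Submodule.sum_mem _ fun c _ => ?_
  by_cases hc : c ∈ s
  · exact Submodule.smul_mem _ _
      (eigenspace_le_spectralSpan T.op hc (Submodule.starProjection_apply_mem _ v))
  · by_cases he : IsEigenvalue T.op c
    · simp [hf c he hc]
    · have hb : eigenspace T.op c = ⊥ := not_not.1 he
      have h0 := (Submodule.eq_bot_iff _).1 hb _
        (Submodule.starProjection_apply_mem (eigenspace T.op c) v)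
      simp [h0]

theorem finiteDimensional_spectralSpan (T : FRsa H) {s : Set ℝ} {M : ℝ}
    (hs : ∀ c ∈ s, |c| ≤ M) : FiniteDimensional ℂ (spectralSpan T.op s) := by
  obtain ⟨R, hR, hRc⟩ := T.compact_resolvent
  -- `f` is `1 + c²`, cut off to be bounded. On `s` the cut-off has no effect, so the compact
  -- operator `R ∘ f(T)` is the identity on the span.
  let f : ℝ →ᵇ ℂ := BoundedContinuousFunction.ofNormedAddCommGroup
    (fun c : ℝ => ((1 + min (c ^ 2) (M ^ 2) : ℝ) : ℂ)) (by fun_prop) (1 + M ^ 2) fun c => by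
      rw [Complex.norm_real, Real.norm_of_nonneg (by positivity)]
      gcongr
      exact min_le_right _ _
  have hK : IsCompactOperator (R ∘L calculus T f) := hRc.comp_clm (calculus T f)
  refine finiteDimensional_of_isCompactOperator_eq_self _ hK _ fun v hv => ?_
  have h : spectralSpan T.op s ≤
      LinearMap.eqLocus (R ∘L calculus T f : H →ₗ[ℂ] H) LinearMap.id := by
    refine iSup₂_le fun c hc u hu => ?_
    have h1 : f c = 1 + (c : ℂ) ^ 2 := by
      change ((1 + min (c ^ 2) (M ^ 2) : ℝ) : ℂ) = _
      rw [min_eq_left (sq_le_sq' (abs_le.1 (hs c hc)).1 (abs_le.1 (hs c hc)).2)]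
      push_cast
      rfl
    change R (calculus T f u) = u
    rw [calculus_apply_of_mem_eigenspace T f hu, h1, resolvent_apply_of_mem_eigenspace hR hu]
  exact h hv

instance finiteDimensional_spectralSpan_Ico (T : FRsa H) (a b : ℝ) :
    FiniteDimensional ℂ (spectralSpan T.op (Set.Ico a b)) :=
  finiteDimensional_spectralSpan T (M := max |a| |b|) fun _ hc =>
    abs_le_max_abs_abs hc.1 hc.2.le

instance finiteDimensional_eigenspace (T : FRsa H) (c : ℝ) :
    FiniteDimensional ℂ (eigenspace T.op c) :=
  Submodule.finiteDimensional_of_le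
    (eigenspace_le_spectralSpan T.op (Set.mem_Ico.2 ⟨le_rfl, lt_add_one c⟩))

theorem multiplicity_ne_zero_iff (T : FRsa H) (c : ℝ) :
    multiplicity T.op c ≠ 0 ↔ IsEigenvalue T.op c :=
  Submodule.finrank_eq_zero.not

/-- Eigenvectors for distinct eigenvalues are linearly independent, and here they all lie in one
finite-dimensional space. -/
theorem finite_eigenvalues_Ico (T : FRsa H) (a b : ℝ) :
    {c | c ∈ Set.Ico a b ∧ IsEigenvalue T.op c}.Finite := by
  let ι := {c // c ∈ Set.Ico a b ∧ IsEigenvalue T.op c}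
  have hex : ∀ c : ι, ∃ v ∈ eigenspace T.op c, v ≠ 0 := fun c =>
    Submodule.exists_mem_ne_zero_of_ne_bot c.2.2
  choose v hv hv0 using hex
  have hli : LinearIndependent ℂ v :=
    ((orthogonalFamily_eigenspace T).independent.comp
      (Subtype.val_injective (p := fun c => c ∈ Set.Ico a b ∧ IsEigenvalue T.op c))).linearIndependent
      _ hv hv0
  let w : ι → spectralSpan T.op (Set.Ico a b) := fun c =>
    ⟨v c, eigenspace_le_spectralSpan T.op c.2.1 (hv c)⟩
  have hw : LinearIndependent ℂ w :=
    LinearIndependent.of_comp (spectralSpan T.op (Set.Ico a b)).subtype hli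
  exact hw.finite_of_isNoetherian

end SpectralSubspaces

/-! ### Counting and numbering the eigenvalues -/

section Counting

variable {H : Type*} [NormedAddCommGroup H] [InnerProductSpace ℂ H]

/-- The number of eigenvalues of `T` in `[a, b)`, counted with multiplicity. -/
noncomputable def rankIco (T : H →ₗ.[ℂ] H) (a b : ℝ) : ℕ :=
  Module.finrank ℂ (spectralSpan T (Set.Ico a b))

theorem rankIco_eq_zero {T : H →ₗ.[ℂ] H} {a b : ℝ}
    (h : ∀ c ∈ Set.Ico a b, ¬ IsEigenvalue T c) : rankIco T a b = 0 := by
  have : spectralSpan T (Set.Ico a b) = ⊥ := by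
    refine le_bot_iff.1 (iSup₂_le fun c hc => ?_)
    exact (not_not.1 (h c hc)).le
  rw [rankIco, this, finrank_bot]

/-- The signed number of eigenvalues of `T` between `a` and `b`. -/
noncomputable def signedCount (T : H →ₗ.[ℂ] H) (a b : ℝ) : ℤ :=
  rankIco T a b - rankIco T b a

variable [CompleteSpace H]

theorem rankIco_add (T : FRsa H) {a b c : ℝ} (hab : a ≤ b) (hbc : b ≤ c) :
    rankIco T.op a c = rankIco T.op a b + rankIco T.op b c := by
  have hdisj : Disjoint (spectralSpan T.op (Set.Ico a b)) (spectralSpan T.op (Set.Ico b c)) :=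
    (orthogonalFamily_eigenspace T).independent.disjoint_biSup_biSup
      (Set.disjoint_left.2 fun x hx hy => not_le.2 hx.2 hy.1)
  have hsup : spectralSpan T.op (Set.Ico a b) ⊔ spectralSpan T.op (Set.Ico b c) =
      spectralSpan T.op (Set.Ico a c) := by
    rw [spectralSpan, spectralSpan, ← iSup_union, Set.Ico_union_Ico_eq_Ico hab hbc, spectralSpan]
  have h := Submodule.finrank_sup_add_finrank_inf_eq (spectralSpan T.op (Set.Ico a b))
    (spectralSpan T.op (Set.Ico b c))
  rwa [hdisj.eq_bot, finrank_bot, add_zero, hsup] at h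

theorem rankIco_pos (T : FRsa H) {a b c : ℝ} (hc : IsEigenvalue T.op c) (hac : a ≤ c)
    (hcb : c < b) : 0 < rankIco T.op a b := by
  refine Nat.pos_of_ne_zero fun h => hc ?_
  rw [rankIco, Submodule.finrank_eq_zero] at h
  exact le_bot_iff.1 (h ▸ eigenspace_le_spectralSpan T.op (Set.mem_Ico.2 ⟨hac, hcb⟩))

/-- At most one of the two terms of `signedCount` is nonzero, since one of the intervals is empty.
The three orderings of `a`, `b`, `c` then reduce to `rankIco_add`. -/
theorem signedCount_of_le (T : FRsa H) (a : ℝ) {b c : ℝ} (hbc : b ≤ c) :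
    signedCount T.op a c = signedCount T.op a b + rankIco T.op b c := by
  have h0 : ∀ {x y : ℝ}, y ≤ x → rankIco T.op x y = 0 := fun h =>
    rankIco_eq_zero fun c hc => absurd (hc.1.trans_lt hc.2) (not_lt.2 h)
  unfold signedCount
  rcases le_total a b with hab | hab
  · rw [h0 hab, h0 (hab.trans hbc), rankIco_add T hab hbc]
    push_cast
    ring
  · rcases le_total a c with hac | hac
    · rw [h0 hab, h0 hac, rankIco_add T hab hac]
      push_cast
      ring
    · rw [h0 hab, h0 hac, rankIco_add T hbc hac]
      push_cast
      ring

theorem signedCount_mono (T : FRsa H) (a : ℝ) : Monotone (signedCount T.op a) := fun b c h => by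
  rw [signedCount_of_le T a h]
  omega

theorem exists_isEigenvalue_ge (T : FRsa H) (b : ℝ) : ∃ c, b ≤ c ∧ IsEigenvalue T.op c := by
  by_contra! h
  refine T.infinite_pos ((finite_eigenvalues_Ico T 0 b).subset fun c hc => ⟨⟨hc.1.le, ?_⟩, hc.2⟩)
  by_contra! hbc
  exact h c hbc hc.2

theorem exists_isEigenvalue_lt (T : FRsa H) (b : ℝ) : ∃ c, c < b ∧ IsEigenvalue T.op c := by
  by_contra! h
  refine T.infinite_neg ((finite_eigenvalues_Ico T b 0).subset fun c hc => ⟨⟨?_, hc.1⟩, hc.2⟩)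
  by_contra! hbc
  exact h c hbc hc.2

theorem exists_lt_signedCount (T : FRsa H) (a : ℝ) (n : ℤ) : ∃ b, n < signedCount T.op a b := by
  have h : ∀ k : ℕ, ∃ b, (k : ℤ) + signedCount T.op a a ≤ signedCount T.op a b := by
    intro k
    induction k with
    | zero => exact ⟨a, by simp⟩
    | succ k ih =>
      obtain ⟨b, hb⟩ := ih
      obtain ⟨c, hbc, hc⟩ := exists_isEigenvalue_ge T b
      have h1 := rankIco_pos T hc hbc (lt_add_one c)
      refine ⟨c + 1, ?_⟩
      rw [signedCount_of_le T a (hbc.trans (lt_add_one c).le)]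
      push_cast
      omega
  obtain ⟨b, hb⟩ := h (n + 1 - signedCount T.op a a).toNat
  exact ⟨b, by omega⟩

theorem exists_signedCount_le (T : FRsa H) (a : ℝ) (n : ℤ) : ∃ b, signedCount T.op a b ≤ n := by
  have h : ∀ k : ℕ, ∃ b, (k : ℤ) + signedCount T.op a b ≤ signedCount T.op a a := by
    intro k
    induction k with
    | zero => exact ⟨a, by simp⟩
    | succ k ih =>
      obtain ⟨b, hb⟩ := ih
      obtain ⟨c, hbc, hc⟩ := exists_isEigenvalue_lt T b
      have h1 := rankIco_pos T hc le_rfl hbc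
      refine ⟨c, ?_⟩
      rw [signedCount_of_le T a hbc.le] at hb
      push_cast
      omega
  obtain ⟨b, hb⟩ := h (signedCount T.op a a - n).toNat
  exact ⟨b, by omega⟩

theorem exists_Ico_not_isEigenvalue (T : FRsa H) (c : ℝ) :
    ∃ b < c, ∀ x ∈ Set.Ico b c, ¬ IsEigenvalue T.op x := by
  have hfin := finite_eigenvalues_Ico T (c - 1) c
  have h : ∀ᶠ b in 𝓝[<] c, ∀ x ∈ {x | x ∈ Set.Ico (c - 1) c ∧ IsEigenvalue T.op x}, x < b := by
    rw [eventually_all_finite hfin]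
    exact fun x hx => nhdsWithin_le_nhds (eventually_gt_nhds hx.1.2)
  have h1 : ∀ᶠ b in 𝓝[<] c, c - 1 < b := nhdsWithin_le_nhds (eventually_gt_nhds (by linarith))
  obtain ⟨b, ⟨hb, hb1⟩, hb2⟩ := ((h.and h1).and self_mem_nhdsWithin).exists
  exact ⟨b, hb2, fun x hx hxe =>
    absurd (hb x ⟨⟨hb1.le.trans hx.1, hx.2⟩, hxe⟩) (not_lt.2 hx.1)⟩

theorem exists_Ioo_not_isEigenvalue (T : FRsa H) (c : ℝ) :
    ∃ b > c, ∀ x ∈ Set.Ioo c b, ¬ IsEigenvalue T.op x := by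
  have hfin := finite_eigenvalues_Ico T c (c + 1)
  have h : ∀ᶠ b in 𝓝[>] c, ∀ x ∈ {x | x ∈ Set.Ico c (c + 1) ∧ IsEigenvalue T.op x},
      c < x → b < x := by
    rw [eventually_all_finite hfin]
    intro x _
    by_cases hx : c < x
    · filter_upwards [nhdsWithin_le_nhds (eventually_lt_nhds hx)] with b hb _ using hb
    · exact Eventually.of_forall fun b hb => absurd hb hx
  have h1 : ∀ᶠ b in 𝓝[>] c, b < c + 1 := nhdsWithin_le_nhds (eventually_lt_nhds (by linarith))
  obtain ⟨b, ⟨hb, hb1⟩, hb2⟩ := ((h.and h1).and self_mem_nhdsWithin).exists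
  exact ⟨b, hb2, fun x hx hxe =>
    absurd (hb x ⟨⟨hx.1.le, hx.2.trans hb1⟩, hxe⟩ hx.1) (not_lt.2 hx.2.le)⟩

theorem exists_not_isEigenvalue_mem_Ioo (T : FRsa H) {a b : ℝ} (hab : a < b) :
    ∃ c ∈ Set.Ioo a b, ¬ IsEigenvalue T.op c := by
  obtain ⟨d, hd, h⟩ := exists_Ioo_not_isEigenvalue T a
  obtain ⟨c, hac, hc⟩ := exists_between (lt_min hab hd)
  exact ⟨c, ⟨hac, hc.trans_le (min_le_left _ _)⟩, h c ⟨hac, hc.trans_le (min_le_right _ _)⟩⟩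

theorem rankIco_eq_multiplicity (T : FRsa H) {c b : ℝ} (hcb : c < b)
    (h : ∀ x ∈ Set.Ioo c b, ¬ IsEigenvalue T.op x) :
    rankIco T.op c b = multiplicity T.op c := by
  have : spectralSpan T.op (Set.Ico c b) = eigenspace T.op c := by
    refine le_antisymm (iSup₂_le fun x hx => ?_)
      (eigenspace_le_spectralSpan T.op (Set.left_mem_Ico.2 hcb))
    rcases hx.1.eq_or_lt with rfl | hlt
    · exact le_rfl
    · rw [not_not.1 (h x ⟨hlt, hx.2⟩)]
      exact bot_le
  rw [rankIco, this, multiplicity]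

/-- The eigenvalues can be enumerated by their position relative to `a`. -/
theorem exists_enumeration (T : FRsa H) (a : ℝ) (n : ℤ) :
    ∃ c, (∀ b, b ≤ c ↔ signedCount T.op a b ≤ n) ∧
      n < signedCount T.op a c + multiplicity T.op c := by
  set S := {b | signedCount T.op a b ≤ n}
  have hne : S.Nonempty := exists_signedCount_le T a n
  obtain ⟨B, hB⟩ := exists_lt_signedCount T a n
  have hbdd : BddAbove S := ⟨B, fun b hb => by
    by_contra! h
    exact absurd (signedCount_mono T a h.le) (not_le.2 (lt_of_le_of_lt hb hB))⟩
  -- The supremum is attained because the count over `[a, b)` is left-continuous in `b`: just below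
  -- `sSup S` there are no eigenvalues.
  have hmem : sSup S ∈ S := by
    obtain ⟨b, hb, h⟩ := exists_Ico_not_isEigenvalue T (sSup S)
    obtain ⟨s, hs, hbs⟩ := exists_lt_of_lt_csSup hne hb
    have h1 := signedCount_of_le T a (le_csSup hbdd hs)
    rw [rankIco_eq_zero fun c hc => h c ⟨hbs.le.trans hc.1, hc.2⟩] at h1
    change _ ≤ n
    change _ ≤ n at hs
    omega
  refine ⟨sSup S, fun b => ⟨fun h => (signedCount_mono T a h).trans hmem,
    fun h => le_csSup hbdd h⟩, ?_⟩
  -- Just to the right of `sSup S` the count has grown by the multiplicity of `sSup S`, and it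
  -- exceeds `n` there because such a `b` is outside `S`.
  obtain ⟨b, hb, h⟩ := exists_Ioo_not_isEigenvalue T (sSup S)
  rw [← rankIco_eq_multiplicity T hb h, ← signedCount_of_le T a (le_of_lt hb)]
  exact not_le.1 fun hbn => not_lt.2 (le_csSup hbdd hbn) hb

end Counting

/-! ### Local constancy of the eigenvalue counts -/

section Stability

/-- A function which is `1` on `[a, b]` and vanishes at distance at least `δ` from it. -/
noncomputable def plateau (a b δ : ℝ) : ℝ →ᵇ ℂ :=
  BoundedContinuousFunction.ofNormedAddCommGroup
    (fun c : ℝ => ((max 0 (min 1 (1 - max (a - c) (c - b) / δ)) : ℝ) : ℂ)) (by fun_prop) 1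
    fun c => by
      rw [Complex.norm_real, Real.norm_of_nonneg (le_max_left _ _)]
      exact max_le zero_le_one (min_le_left _ _)

theorem plateau_apply (a b δ c : ℝ) :
    plateau a b δ c = ((max 0 (min 1 (1 - max (a - c) (c - b) / δ)) : ℝ) : ℂ) := rfl

theorem plateau_eq_one {a b δ c : ℝ} (hδ : 0 < δ) (hc : c ∈ Set.Icc a b) :
    plateau a b δ c = 1 := by
  have h : max (a - c) (c - b) / δ ≤ 0 :=
    div_nonpos_of_nonpos_of_nonneg (max_le (by linarith [hc.1]) (by linarith [hc.2])) hδ.le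
  rw [plateau_apply, min_eq_left (by linarith), max_eq_right zero_le_one, Complex.ofReal_one]

theorem plateau_eq_zero {a b δ c : ℝ} (hδ : 0 < δ) (hc : c ≤ a - δ ∨ b + δ ≤ c) :
    plateau a b δ c = 0 := by
  have h : 1 ≤ max (a - c) (c - b) / δ := by
    rw [one_le_div hδ, le_max_iff]
    exact hc.imp (fun h => by linarith) fun h => by linarith
  rw [plateau_apply, max_eq_left ((min_le_right _ _).trans (by linarith)), Complex.ofReal_zero]

theorem plateau_mem_Cb {a b δ : ℝ} (hδ : 0 < δ) : plateau a b δ ∈ Cb := by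
  refine ⟨⟨0, tendsto_const_nhds.congr' ?_⟩, ⟨0, tendsto_const_nhds.congr' ?_⟩⟩
  · filter_upwards [eventually_ge_atTop (b + δ)] with c hc
    exact (plateau_eq_zero hδ (Or.inr hc)).symm
  · filter_upwards [eventually_le_atBot (a - δ)] with c hc
    exact (plateau_eq_zero hδ (Or.inl hc)).symm

theorem half_le_norm_plateau {c δ t : ℝ} (hδ : 0 < δ) (ht : |t - c| ≤ δ / 2) :
    1 / 2 ≤ ‖plateau c c δ t‖ := by
  have h : max (c - t) (t - c) / δ ≤ 1 / 2 := by
    rw [div_le_iff₀ hδ]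
    have := abs_le.1 ht
    exact max_le (by linarith) (by linarith)
  rw [plateau_apply, Complex.norm_real, Real.norm_of_nonneg (le_max_left _ _)]
  exact le_max_of_le_right (le_min (by norm_num) (by linarith))

variable {H : Type*} [NormedAddCommGroup H] [InnerProductSpace ℂ H] [CompleteSpace H]

theorem exists_gap (T : FRsa H) {c : ℝ} (hc : ¬ IsEigenvalue T.op c) :
    ∃ δ > 0, ∀ t, |t - c| < δ → ¬ IsEigenvalue T.op t := by
  obtain ⟨l, hl, hl'⟩ := exists_Ico_not_isEigenvalue T c
  obtain ⟨r, hr, hr'⟩ := exists_Ioo_not_isEigenvalue T c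
  refine ⟨min (c - l) (r - c), lt_min (sub_pos.2 hl) (sub_pos.2 hr), fun t ht => ?_⟩
  obtain ⟨h1, h2⟩ := lt_min_iff.1 ht
  rw [abs_lt] at h1 h2
  rcases lt_trichotomy t c with h | rfl | h
  · exact hl' t ⟨by linarith, h⟩
  · exact hc
  · exact hr' t ⟨h, by linarith⟩

/-- `f(T)` maps the spectral subspace of `S` into that of `T`. It is injective there: `f(S)` is the
identity on that subspace, so a vector killed by `f(T)` would be moved by `f(S) - f(T)` with no loss
of norm. -/
theorem rankIco_le_of_norm_calculus_sub_lt {S T : FRsa H} {a b : ℝ} (f : ℝ →ᵇ ℂ)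
    (hf : ∀ c ∈ Set.Ico a b, f c = 1)
    (hT : ∀ c, IsEigenvalue T.op c → c ∉ Set.Ico a b → f c = 0)
    (h : ‖calculus S f - calculus T f‖ < 1) : rankIco S.op a b ≤ rankIco T.op a b := by
  let φ : spectralSpan S.op (Set.Ico a b) →ₗ[ℂ] spectralSpan T.op (Set.Ico a b) :=
    LinearMap.codRestrict _
      ((calculus T f : H →ₗ[ℂ] H).comp (spectralSpan S.op (Set.Ico a b)).subtype)
      fun v => calculus_mem_spectralSpan T f hT v
  refine LinearMap.finrank_le_finrank_of_injective (f := φ) ?_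
  rw [← LinearMap.ker_eq_bot, LinearMap.ker_eq_bot']
  intro v hv
  have h1 : calculus T f v = 0 := congrArg Subtype.val hv
  have h2 := (calculus S f - calculus T f).le_opNorm v
  rw [sub_apply, h1, sub_zero,
    calculus_apply_of_mem_spectralSpan S f hf v.2] at h2
  by_contra hv0
  have h3 : 0 < ‖(v : H)‖ := norm_pos_iff.2 fun h => hv0 (Subtype.ext h)
  nlinarith

variable {X : Type*} [TopologicalSpace X] {D : X → FRsa H}

theorem IsContinuousFamily.continuous_calculus (hD : IsContinuousFamily D) {f : ℝ →ᵇ ℂ}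
    (hf : f ∈ Cb) : Continuous fun x => calculus (D x) f :=
  hD.comp (f := fun x => ((⟨f, hf⟩ : Cb), x)) (by fun_prop)

/-- A bump of radius `δ` at `c` misses the spectrum of `D x`, so its calculus vanishes at `x` and
has norm below `1/2` nearby. An eigenvalue within `δ / 2` of `c`, where the bump is at least `1/2`,
would contradict this. -/
theorem IsContinuousFamily.eventually_gap (hD : IsContinuousFamily D) {x : X} {c δ : ℝ}
    (hδ : 0 < δ) (h : ∀ t, |t - c| < δ → ¬ IsEigenvalue (D x).op t) :
    ∀ᶠ y in 𝓝 x, ∀ t, |t - c| < δ / 2 → ¬ IsEigenvalue (D y).op t := by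
  have h0 : calculus (D x) (plateau c c δ) = 0 := by
    have : spectralSpan (D x).op ∅ = ⊥ := by simp [spectralSpan]
    have : FiniteDimensional ℂ (spectralSpan (D x).op ∅) :=
      finiteDimensional_spectralSpan (D x) (M := 0) (by simp)
    ext v
    have hv := calculus_mem_spectralSpan (D x) (plateau c c δ) (s := ∅) (fun t ht _ => by
      have h1 : δ ≤ |t - c| := not_lt.1 fun h1 => h t h1 ht
      exact plateau_eq_zero hδ ((le_abs'.1 h1).imp (fun _ => by linarith) fun _ => by linarith)) v
    simpa [spectralSpan] using hv
  have h1 := (hD.continuous_calculus (plateau_mem_Cb (a := c) (b := c) hδ)).norm.tendsto x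
  rw [h0, norm_zero] at h1
  filter_upwards [h1.eventually (eventually_lt_nhds (by norm_num : (0 : ℝ) < 1 / 2))] with y hy
  intro t ht hte
  have h2 := norm_apply_le_norm_calculus (D y) (plateau c c δ) hte
  linarith [half_le_norm_plateau hδ ht.le]

theorem IsContinuousFamily.isOpen_not_isEigenvalue (hD : IsContinuousFamily D) (c : ℝ) :
    IsOpen {x | ¬ IsEigenvalue (D x).op c} := by
  rw [isOpen_iff_eventually]
  intro x hx
  obtain ⟨δ, hδ, h⟩ := exists_gap (D x) hx
  filter_upwards [hD.eventually_gap hδ h] with y hy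
  exact hy c (by simpa using hδ)

theorem IsContinuousFamily.eventually_rankIco_eq (hD : IsContinuousFamily D) {x : X} {a b : ℝ}
    (ha : ¬ IsEigenvalue (D x).op a) (hb : ¬ IsEigenvalue (D x).op b) :
    ∀ᶠ y in 𝓝 x, rankIco (D y).op a b = rankIco (D x).op a b := by
  obtain ⟨δ₁, hδ₁, h₁⟩ := exists_gap (D x) ha
  obtain ⟨δ₂, hδ₂, h₂⟩ := exists_gap (D x) hb
  -- Gaps at the endpoints survive at half their width for nearby `y`. With this `δ`, one plateau
  -- vanishes at all eigenvalues outside `[a, b)` both for `D x` and for `D y`, so the rank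
  -- inequality holds in both directions.
  set δ := min δ₁ δ₂ / 2 with hδ_def
  have hδ : 0 < δ := half_pos (lt_min hδ₁ hδ₂)
  have hδ₁' : δ ≤ δ₁ / 2 := by rw [hδ_def]; gcongr; exact min_le_left _ _
  have hδ₂' : δ ≤ δ₂ / 2 := by rw [hδ_def]; gcongr; exact min_le_right _ _
  have hvan : ∀ y, (∀ t, |t - a| < δ₁ / 2 → ¬ IsEigenvalue (D y).op t) →
      (∀ t, |t - b| < δ₂ / 2 → ¬ IsEigenvalue (D y).op t) →
      ∀ c, IsEigenvalue (D y).op c → c ∉ Set.Ico a b → plateau a b δ c = 0 := by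
    intro y hya hyb c hc hcab
    have h3 : δ ≤ |c - a| := hδ₁'.trans (not_lt.1 fun h => hya c h hc)
    have h4 : δ ≤ |c - b| := hδ₂'.trans (not_lt.1 fun h => hyb c h hc)
    refine plateau_eq_zero hδ ?_
    rw [Set.mem_Ico, not_and_or, not_le, not_lt] at hcab
    rcases hcab with h | h
    · rw [abs_of_neg (by linarith)] at h3
      exact Or.inl (by linarith)
    · rw [abs_of_nonneg (by linarith)] at h4
      exact Or.inr (by linarith)
  have hone : ∀ c ∈ Set.Ico a b, plateau a b δ c = 1 := fun c hc =>
    plateau_eq_one hδ ⟨hc.1, hc.2.le⟩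
  have hx := hvan x (fun t ht => h₁ t (by linarith)) fun t ht => h₂ t (by linarith)
  have hnear : ∀ᶠ y in 𝓝 x,
      ‖calculus (D y) (plateau a b δ) - calculus (D x) (plateau a b δ)‖ < 1 := by
    have := Metric.tendsto_nhds.1
      ((hD.continuous_calculus (plateau_mem_Cb (a := a) (b := b) hδ)).tendsto x) 1 one_pos
    simpa only [dist_eq_norm] using this
  filter_upwards [hD.eventually_gap hδ₁ h₁, hD.eventually_gap hδ₂ h₂, hnear] with y hya hyb hy
  refine le_antisymm (rankIco_le_of_norm_calculus_sub_lt _ hone hx hy)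
    (rankIco_le_of_norm_calculus_sub_lt _ hone (hvan y hya hyb) ?_)
  rwa [norm_sub_rev]

theorem IsContinuousFamily.eventually_signedCount_eq (hD : IsContinuousFamily D) {x : X}
    {a b : ℝ} (ha : ¬ IsEigenvalue (D x).op a) (hb : ¬ IsEigenvalue (D x).op b) :
    ∀ᶠ y in 𝓝 x, signedCount (D y).op a b = signedCount (D x).op a b := by
  filter_upwards [hD.eventually_rankIco_eq ha hb, hD.eventually_rankIco_eq hb ha] with y h1 h2
  rw [signedCount, signedCount, h1, h2]

end Stability

/-! ### Local spectral exhaustions -/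

section LocalExhaustions

variable {H : Type*} [NormedAddCommGroup H] [InnerProductSpace ℂ H] [CompleteSpace H]

/-- The eigenvalue of `T` with number `n`, counted from `a` upwards. -/
noncomputable def nthEigenvalue (T : FRsa H) (a : ℝ) (n : ℤ) : ℝ :=
  (exists_enumeration T a n).choose

theorem le_nthEigenvalue_iff (T : FRsa H) (a : ℝ) (n : ℤ) (b : ℝ) :
    b ≤ nthEigenvalue T a n ↔ signedCount T.op a b ≤ n :=
  (exists_enumeration T a n).choose_spec.1 b

theorem lt_signedCount_nthEigenvalue (T : FRsa H) (a : ℝ) (n : ℤ) :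
    n < signedCount T.op a (nthEigenvalue T a n) + multiplicity T.op (nthEigenvalue T a n) :=
  (exists_enumeration T a n).choose_spec.2

theorem nthEigenvalue_eq_iff (T : FRsa H) (a : ℝ) (n : ℤ) (c : ℝ) :
    nthEigenvalue T a n = c ↔
      n ∈ Set.Ico (signedCount T.op a c) (signedCount T.op a c + multiplicity T.op c) := by
  constructor
  · rintro rfl
    exact ⟨(le_nthEigenvalue_iff T a n _).1 le_rfl, lt_signedCount_nthEigenvalue T a n⟩
  · rintro ⟨h1, h2⟩
    refine le_antisymm (not_lt.1 fun h => ?_) ((le_nthEigenvalue_iff T a n c).2 h1)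
    have h3 := (le_nthEigenvalue_iff T a n _).1 le_rfl
    rw [signedCount_of_le T a h.le] at h3
    have h4 : multiplicity T.op c ≤ rankIco T.op c (nthEigenvalue T a n) :=
      Submodule.finrank_mono (eigenspace_le_spectralSpan T.op (Set.left_mem_Ico.2 h))
    omega

theorem isEigenvalue_nthEigenvalue (T : FRsa H) (a : ℝ) (n : ℤ) :
    IsEigenvalue T.op (nthEigenvalue T a n) := by
  rw [← multiplicity_ne_zero_iff]
  have h1 := (le_nthEigenvalue_iff T a n _).1 le_rfl
  have h2 := lt_signedCount_nthEigenvalue T a n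
  omega

variable {X : Type*} [TopologicalSpace X] {D : X → FRsa H}

/-- By `le_nthEigenvalue_iff`, a strict bound on the eigenvalue follows from the count up to a
nearby level `c`. Choosing `c` outside the spectrum of `D x` makes that count locally constant. -/
theorem IsContinuousFamily.continuousAt_nthEigenvalue (hD : IsContinuousFamily D) {x : X}
    {a : ℝ} (ha : ¬ IsEigenvalue (D x).op a) (n : ℤ) :
    ContinuousAt (fun y => nthEigenvalue (D y) a n) x := by
  refine tendsto_order.2 ⟨fun b hb => ?_, fun b hb => ?_⟩
  · obtain ⟨c, hc, hce⟩ := exists_not_isEigenvalue_mem_Ioo (D x) hb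
    filter_upwards [hD.eventually_signedCount_eq ha hce] with y hy
    refine hc.1.trans_le ((le_nthEigenvalue_iff _ _ _ _).2 ?_)
    rw [hy]
    exact (le_nthEigenvalue_iff _ _ _ _).1 hc.2.le
  · obtain ⟨c, hc, hce⟩ := exists_not_isEigenvalue_mem_Ioo (D x) hb
    filter_upwards [hD.eventually_signedCount_eq ha hce] with y hy
    refine lt_of_lt_of_le (not_le.1 fun h => not_le.2 hc.1 ?_) hc.2.le
    rw [le_nthEigenvalue_iff, hy] at h
    exact (le_nthEigenvalue_iff _ _ _ _).2 h

theorem IsContinuousFamily.isSpectralExhaustion_nthEigenvalue (hD : IsContinuousFamily D)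
    {a : ℝ} {V : Set X} (hV : ∀ x ∈ V, ¬ IsEigenvalue (D x).op a) :
    IsSpectralExhaustion (fun x : V => D x) fun n x => nthEigenvalue (D x) a n where
  continuous n := continuous_iff_continuousAt.2 fun x =>
    (hD.continuousAt_nthEigenvalue (hV x x.2) n).comp continuous_subtype_val.continuousAt
  isEigenvalue n x := isEigenvalue_nthEigenvalue (D x) a n
  exhausts x c _ := by
    simp only [nthEigenvalue_eq_iff, Set.ofPred_mem_eq]
    rw [← Finset.coe_Ico, Set.encard_coe_eq_coe_finsetCard, Int.card_Ico]
    simp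
  mono n x := (le_nthEigenvalue_iff _ _ _ _).2
    (((le_nthEigenvalue_iff _ _ _ _).1 le_rfl).trans (by omega))

end LocalExhaustions

/-! ### Comparison of two spectral exhaustions -/

section Shifts

variable {H : Type*} [NormedAddCommGroup H] [InnerProductSpace ℂ H] [CompleteSpace H]
variable {X : Type*} [TopologicalSpace X] {D : X → FRsa H} {μ κ : ℤ → X → ℝ}

theorem IsSpectralExhaustion.comp {Y : Type*} [TopologicalSpace Y]
    (h : IsSpectralExhaustion D μ) {g : Y → X} (hg : Continuous g) :
    IsSpectralExhaustion (fun y => D (g y)) fun n y => μ n (g y) where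
  continuous n := (h.continuous n).comp hg
  isEigenvalue n y := h.isEigenvalue n (g y)
  exhausts y c hc := h.exhausts (g y) c hc
  mono n y := h.mono n (g y)

theorem IsSpectralExhaustion.monotone (h : IsSpectralExhaustion D μ) (x : X) :
    Monotone fun n => μ n x :=
  monotone_int_of_le_succ fun n => h.mono n x

theorem IsSpectralExhaustion.exists_eq (h : IsSpectralExhaustion D μ) {x : X} {c : ℝ}
    (hc : IsEigenvalue (D x).op c) : ∃ n, μ n x = c := by
  have h1 : {n : ℤ | μ n x = c}.encard ≠ 0 := by
    rw [h.exhausts x c hc]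
    exact_mod_cast (multiplicity_ne_zero_iff (D x) c).2 hc
  exact Set.encard_ne_zero.1 h1

/-- The indices with `b ≤ μ n x` are closed upwards by monotonicity. They are nonempty and bounded
below because there are eigenvalues on both sides of `b`. The thresholds `N`, for all `b`, determine
the sequence. -/
theorem IsSpectralExhaustion.exists_le_iff (h : IsSpectralExhaustion D μ) (x : X) (b : ℝ) :
    ∃ N : ℤ, ∀ n, b ≤ μ n x ↔ N ≤ n := by
  obtain ⟨c, hbc, hc⟩ := exists_isEigenvalue_ge (D x) b
  obtain ⟨d, hdb, hd⟩ := exists_isEigenvalue_lt (D x) b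
  obtain ⟨n, rfl⟩ := h.exists_eq hc
  obtain ⟨m, rfl⟩ := h.exists_eq hd
  obtain ⟨N, hN, hmin⟩ := Int.exists_least_of_bdd (P := fun k => b ≤ μ k x)
    ⟨m, fun k hk => not_lt.1 fun hkm => not_lt.2 (hk.trans (h.monotone x hkm.le)) hdb⟩ ⟨n, hbc⟩
  exact ⟨N, fun k => ⟨hmin k, fun hk => hN.trans (h.monotone x hk)⟩⟩

theorem IsSpectralExhaustion.encard_fiber_eq (h : IsSpectralExhaustion D μ)
    (h' : IsSpectralExhaustion D κ) (x : X) (c : ℝ) :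
    {n : ℤ | μ n x = c}.encard = {n : ℤ | κ n x = c}.encard := by
  by_cases hc : IsEigenvalue (D x).op c
  · rw [h.exhausts x c hc, h'.exhausts x c hc]
  · have h1 : {n : ℤ | μ n x = c} = ∅ :=
      Set.eq_empty_of_forall_notMem fun n hn => hc (hn ▸ h.isEigenvalue n x)
    have h2 : {n : ℤ | κ n x = c} = ∅ :=
      Set.eq_empty_of_forall_notMem fun n hn => hc (hn ▸ h'.isEigenvalue n x)
    rw [h1, h2]

theorem IsSpectralExhaustion.finite_fiber (h : IsSpectralExhaustion D μ) (x : X) (c : ℝ) :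
    {n : ℤ | μ n x = c}.Finite := by
  by_cases hc : IsEigenvalue (D x).op c
  · exact Set.finite_of_encard_eq_coe (h.exhausts x c hc)
  · convert Set.finite_empty
    exact Set.eq_empty_of_forall_notMem fun n hn => hc (hn ▸ h.isEigenvalue n x)

/-- Over each value both fibres are finite of the same size; bijections between them are put
together. -/
theorem IsSpectralExhaustion.exists_perm (h : IsSpectralExhaustion D μ)
    (h' : IsSpectralExhaustion D κ) (x : X) : ∃ φ : ℤ ≃ ℤ, ∀ n, κ (φ n) x = μ n x := by
  have hex : ∀ c, Nonempty ({n : ℤ // μ n x = c} ≃ {n : ℤ // κ n x = c}) := fun c => by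
    have : Finite {n : ℤ // μ n x = c} := h.finite_fiber x c
    have : Finite {n : ℤ // κ n x = c} := h'.finite_fiber x c
    refine Finite.card_eq.1 ?_
    exact congrArg ENat.toNat (h.encard_fiber_eq h' x c)
  exact ⟨Equiv.ofFiberEquiv fun c => (hex c).some, fun n => Equiv.ofFiberEquiv_map (g := fun n => κ n x) _ n⟩

/-- Let `N b` and `M b` be the thresholds of the two sequences. The value-preserving permutation
carries `[N b, N c)` onto `[M b, M c)`, so `M - N` is constant; this constant is the shift, as
thresholds determine a sequence. -/
theorem IsSpectralExhaustion.exists_shift (h : IsSpectralExhaustion D μ)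
    (h' : IsSpectralExhaustion D κ) (x : X) : ∃ k : ℤ, ∀ n, μ n x = κ (n + k) x := by
  obtain ⟨φ, hφ⟩ := h.exists_perm h' x
  choose N hN using h.exists_le_iff x
  choose M hM using h'.exists_le_iff x
  have hle : ∀ {b c : ℝ}, b ≤ c → N b ≤ N c ∧ M b ≤ M c := fun hbc =>
    ⟨(hN _ _).1 (hbc.trans ((hN _ _).2 le_rfl)), (hM _ _).1 (hbc.trans ((hM _ _).2 le_rfl))⟩
  have key : ∀ {b c : ℝ}, b ≤ c → M c - N c = M b - N b := fun {b c} hbc => by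
    have himg : φ '' Set.Ico (N b) (N c) = Set.Ico (M b) (M c) := by
      ext m
      rw [Equiv.image_eq_preimage_symm, Set.mem_preimage, Set.mem_Ico, Set.mem_Ico, ← not_le,
        ← not_le, ← hN, ← hN, ← hM, ← hM, ← hφ, Equiv.apply_symm_apply]
    have hcard := Set.ncard_image_of_injective (Set.Ico (N b) (N c)) φ.injective
    rw [himg, ← Finset.coe_Ico, ← Finset.coe_Ico, Set.ncard_coe_finset, Set.ncard_coe_finset,
      Int.card_Ico, Int.card_Ico] at hcard
    have := hle hbc
    omega
  have key0 : ∀ b, M b - N b = M 0 - N 0 := fun b =>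
    (le_total b 0).elim (fun hb => (key hb).symm) fun hb => key hb
  refine ⟨M 0 - N 0, fun n => eq_of_forall_le_iff fun b => ?_⟩
  rw [hN, hM]
  have := key0 b
  omega

/-- Otherwise the sequence would be periodic, which is incompatible with a threshold index at level
`0`. -/
theorem IsSpectralExhaustion.shift_unique (h : IsSpectralExhaustion D μ) {x : X} {j k : ℤ}
    (hjk : ∀ n, μ (n + j) x = μ (n + k) x) : j = k := by
  obtain ⟨N, hN⟩ := h.exists_le_iff x 0
  have h1 := (hN (N - k + j)).1 ((hjk (N - k)).symm ▸ (hN _).2 (by omega))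
  have h2 := (hN (N - j + k)).1 ((hjk (N - j)) ▸ (hN _).2 (by omega))
  omega

/-- Two spectral exhaustions of the same family differ by a locally constant shift. -/
theorem IsSpectralExhaustion.exists_locallyConstant_shift (h : IsSpectralExhaustion D μ)
    (h' : IsSpectralExhaustion D κ) :
    ∃ s : LocallyConstant X ℤ, ∀ x n, μ n x = κ (n + s x) x := by
  choose s hs using h.exists_shift h'
  refine ⟨⟨s, (IsLocallyConstant.iff_eventually_eq _).2 fun x => ?_⟩, hs⟩
  -- At the threshold `N` the sequence jumps strictly, and `b` is put inside the jump. By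
  -- continuity, for `y` near `x` both sequences still cross `b` at the same indices as at `x`,
  -- which forces `s y = s x`.
  obtain ⟨N, hN⟩ := h.exists_le_iff x 0
  have hgap : μ (N - 1) x < μ N x :=
    (not_le.1 fun h0 => absurd ((hN _).1 h0) (by omega)).trans_le ((hN N).2 le_rfl)
  obtain ⟨b, hb1, hb2⟩ := exists_between hgap
  have hgap1 := hb1
  have hgap2 := hb2
  rw [hs] at hgap1 hgap2
  filter_upwards [(h.continuous (N - 1)).continuousAt.eventually (eventually_lt_nhds hb1),
    (h.continuous N).continuousAt.eventually (eventually_gt_nhds hb2),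
    (h'.continuous (N - 1 + s x)).continuousAt.eventually (eventually_lt_nhds hgap1),
    (h'.continuous (N + s x)).continuousAt.eventually (eventually_gt_nhds hgap2)]
    with y h1 h2 h3 h4
  rw [hs] at h1 h2
  have h5 : N - 1 + s y < N + s x := not_le.1 fun h5 =>
    lt_asymm h4 ((h'.monotone y h5).trans_lt h1)
  have h6 : N - 1 + s x < N + s y := not_le.1 fun h6 =>
    lt_asymm h2 ((h'.monotone y h6).trans_lt h3)
  omega

end Shifts

/-! ### Čech classes in the direct limit -/

section CechClasses

variable {X : Type*} [TopologicalSpace X]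

theorem cechClass_resZ1 {U V : PointedCover X} (h : U ≤ V) (ν : U.Z1) :
    cechClass V (PointedCover.resZ1 h ν) = cechClass U ν := by
  classical
  exact AddCommGroup.DirectLimit.of_f (G := fun U : PointedCover X => U.H1)
    (f := PointedCover.resH1) (hij := h) (x := QuotientAddGroup.mk ν)

theorem cechClass_eq_of_sub_eq_d0 {U : PointedCover X} {ν ν' : U.Z1} (σ : U.C0)
    (h : U.d0 σ = -ν.1 + ν'.1) : cechClass U ν = cechClass U ν' := by
  unfold cechClass
  congr 1
  exact QuotientAddGroup.eq.2 ⟨σ, h⟩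

theorem cechClass_zero (U : PointedCover X) : cechClass U 0 = 0 :=
  map_zero _

theorem exists_resZ1_eq_d0_of_cechClass_eq_zero {U : PointedCover X} {ν : U.Z1}
    (h : cechClass U ν = 0) :
    ∃ (V : PointedCover X) (hUV : U ≤ V) (σ : V.C0), V.d0 σ = (PointedCover.resZ1 hUV ν).1 := by
  classical
  obtain ⟨V, hUV, hV⟩ := AddCommGroup.DirectLimit.of.zero_exact _ _ h
  obtain ⟨σ, hσ⟩ := (QuotientAddGroup.eq_zero_iff _).1 hV
  exact ⟨V, hUV, σ, hσ⟩

end CechClasses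

/-! ### Existence and uniqueness of the class, and gluing -/

section SpectralFlowClass

variable {H : Type*} [NormedAddCommGroup H] [InnerProductSpace ℂ H] [CompleteSpace H]
variable {X : Type*} [TopologicalSpace X] {D : X → FRsa H}

theorem exists_isSpectralFlow_of_exhaustions (U : PointedCover X)
    (μ : ∀ x, ℤ → U.nhd x → ℝ)
    (hμ : ∀ x, IsSpectralExhaustion (fun p : U.nhd x => D p) (μ x)) :
    ∃ a, IsSpectralFlow D a := by
  have hl : ∀ x y, IsSpectralExhaustion (fun p : (U.nhd x ⊓ U.nhd y : Opens X) => D p)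
      fun n p => μ x n ⟨p, p.2.1⟩ := fun x y =>
    (hμ x).comp (continuous_inclusion (inf_le_left : U.nhd x ⊓ U.nhd y ≤ U.nhd x))
  have hr : ∀ x y, IsSpectralExhaustion (fun p : (U.nhd x ⊓ U.nhd y : Opens X) => D p)
      fun n p => μ y n ⟨p, p.2.2⟩ := fun x y =>
    (hμ y).comp (continuous_inclusion (inf_le_right : U.nhd x ⊓ U.nhd y ≤ U.nhd y))
  choose ν hν using fun x y => (hl x y).exists_locallyConstant_shift (hr x y)
  have hZ : ν ∈ U.Z1 := by
    rw [AddMonoidHom.mem_ker]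
    funext x y z
    ext p
    change ν y z ⟨p, p.2.1.2, p.2.2⟩ - ν x z ⟨p, p.2.1.1, p.2.2⟩ + ν x y ⟨p, p.2.1⟩ = 0
    -- Passing from `μ x` to `μ z` directly or through `μ y` gives two shifts of `μ z` with the same
    -- result.
    have hj := (hμ z).shift_unique (x := ⟨p, p.2.2⟩)
      (j := ν x y ⟨p, p.2.1⟩ + ν y z ⟨p, p.2.1.2, p.2.2⟩)
      (k := ν x z ⟨p, p.2.1.1, p.2.2⟩) fun n => by
        rw [← hν x z ⟨p, p.2.1.1, p.2.2⟩ n, ← add_assoc,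
          ← hν y z ⟨p, p.2.1.2, p.2.2⟩ (n + ν x y ⟨p, p.2.1⟩)]
        exact (hν x y ⟨p, p.2.1⟩ n).symm
    omega
  exact ⟨_, U, μ, ⟨ν, hZ⟩, hμ, hν, rfl⟩

theorem IsContinuousFamily.exists_isSpectralFlow (hD : IsContinuousFamily D) :
    ∃ a, IsSpectralFlow D a := by
  have hex : ∀ x, ∃ a, ¬ IsEigenvalue (D x).op a := fun x =>
    (exists_not_isEigenvalue_mem_Ioo (D x) zero_lt_one).imp fun _ h => h.2
  choose a ha using hex
  -- The set with index `x` consists of the points where the base level `a x` is still outside the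
  -- spectrum.
  exact exists_isSpectralFlow_of_exhaustions
    ⟨fun x => ⟨{y | ¬ IsEigenvalue (D y).op (a x)}, hD.isOpen_not_isEigenvalue (a x)⟩, ha⟩
    (fun x n p => nthEigenvalue (D p) (a x) n)
    fun x => hD.isSpectralExhaustion_nthEigenvalue fun _ h => h

theorem IsSpectralFlow.unique {a b : CechH1 X} (ha : IsSpectralFlow D a)
    (hb : IsSpectralFlow D b) : a = b := by
  obtain ⟨U, μ, ν, hμ, hν, rfl⟩ := ha
  obtain ⟨V, κ, ν', hκ, hν', rfl⟩ := hb
  obtain ⟨W, hUW, hVW⟩ := exists_ge_ge U V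
  have hl : ∀ x, IsSpectralExhaustion (fun p : W.nhd x => D p)
      fun n p => μ x n ⟨p, hUW x p.2⟩ := fun x => (hμ x).comp (continuous_inclusion (hUW x))
  have hr : ∀ x, IsSpectralExhaustion (fun p : W.nhd x => D p)
      fun n p => κ x n ⟨p, hVW x p.2⟩ := fun x => (hκ x).comp (continuous_inclusion (hVW x))
  -- `σ x` is the shift from `μ x` to `κ x`. The two routes from `μ x` to `κ y`, through `μ y` and
  -- through `κ x`, give `ν + σ y = σ x + ν'`, so `σ` bounds the difference of the cocycles.
  choose σ hσ using fun x => (hl x).exists_locallyConstant_shift (hr x)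
  rw [← cechClass_resZ1 hUW, ← cechClass_resZ1 hVW]
  refine cechClass_eq_of_sub_eq_d0 σ ?_
  funext x y
  ext p
  have hpU : (p : X) ∈ U.nhd x ⊓ U.nhd y := ⟨hUW x p.2.1, hUW y p.2.2⟩
  have hpV : (p : X) ∈ V.nhd x ⊓ V.nhd y := ⟨hVW x p.2.1, hVW y p.2.2⟩
  change σ y ⟨p, p.2.2⟩ - σ x ⟨p, p.2.1⟩ = -ν.1 x y ⟨p, hpU⟩ + ν'.1 x y ⟨p, hpV⟩
  have hj := (hκ y).shift_unique (x := ⟨p, hVW y p.2.2⟩)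
    (j := ν.1 x y ⟨p, hpU⟩ + σ y ⟨p, p.2.2⟩)
    (k := σ x ⟨p, p.2.1⟩ + ν'.1 x y ⟨p, hpV⟩) fun n => by
      rw [← add_assoc, ← add_assoc, ← hσ y ⟨p, p.2.2⟩, ← hν x y ⟨p, hpU⟩ n,
        ← hν' x y ⟨p, hpV⟩]
      exact hσ x ⟨p, p.2.1⟩ n
  omega

theorem IsContinuousFamily.isSpectralFlow_iff (hD : IsContinuousFamily D) (a : CechH1 X) :
    IsSpectralFlow D a ↔ a = spectralFlow D := by
  have h : IsSpectralFlow D (spectralFlow D) := by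
    rw [spectralFlow, dif_pos hD.exists_isSpectralFlow]
    exact hD.exists_isSpectralFlow.choose_spec
  exact ⟨fun ha => ha.unique h, fun ha => ha ▸ h⟩

theorem IsSpectralExhaustion.isSpectralFlow_zero {μ : ℤ → X → ℝ}
    (h : IsSpectralExhaustion D μ) : IsSpectralFlow D 0 :=
  ⟨⟨fun _ => ⊤, fun _ => trivial⟩, fun _ n p => μ n p, 0, fun _ => h.comp continuous_subtype_val,
    fun _ _ p n => congrArg (μ · p) (add_zero n).symm, cechClass_zero _⟩

theorem IsSpectralFlow.exists_isSpectralExhaustion (h : IsSpectralFlow D 0) :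
    ∃ μ : ℤ → X → ℝ, IsSpectralExhaustion D μ := by
  obtain ⟨U, μ, ν, hμ, hν, h0⟩ := h
  obtain ⟨V, hUV, σ, hσ⟩ := exists_resZ1_eq_d0_of_cechClass_eq_zero h0
  have hglue : ∀ (x y p : X) (hx : p ∈ V.nhd x) (hy : p ∈ V.nhd y) (n : ℤ),
      μ x (n + σ x ⟨p, hx⟩) ⟨p, hUV x hx⟩ = μ y (n + σ y ⟨p, hy⟩) ⟨p, hUV y hy⟩ := by
    intro x y p hx hy n
    have h1 : σ y ⟨p, hy⟩ - σ x ⟨p, hx⟩ = ν.1 x y ⟨p, hUV x hx, hUV y hy⟩ :=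
      DFunLike.congr_fun (congrFun (congrFun hσ x) y) ⟨p, hx, hy⟩
    rw [hν x y ⟨p, hUV x hx, hUV y hy⟩, ← h1]
    congr 1
    ring
  -- At `p` the set with index `p` is used. By `hglue` any other set containing `p` gives the same
  -- value, so near `x` the function can be computed with the fixed index `x`, where continuity is
  -- visible.
  refine ⟨fun n p => μ p (n + σ p ⟨p, V.mem_nhd p⟩) ⟨p, hUV p (V.mem_nhd p)⟩, ?_, ?_, ?_, ?_⟩
  · intro n
    rw [continuous_iff_continuousAt]
    intro x
    have hx := (V.nhd x).isOpen.mem_nhds (V.mem_nhd x)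
    refine ContinuousOn.continuousAt (s := V.nhd x) ?_ hx
    rw [continuousOn_iff_continuous_domRestrict]
    have hc : Continuous fun p : V.nhd x => μ x (n + σ x p) ⟨p, hUV x p.2⟩ := by
      rw [continuous_iff_continuousAt]
      intro p
      refine (((hμ x).continuous (n + σ x p)).comp
        (continuous_inclusion (hUV x))).continuousAt.congr ?_
      filter_upwards [(σ x).isLocallyConstant.eventually_eq p] with q hq
      have hq' : σ x q = σ x p := hq
      exact congrArg (fun k => μ x (n + k) ⟨q, hUV x q.2⟩) hq'.symm
    exact hc.congr fun p => hglue x p p p.2 _ n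
  · exact fun n p => (hμ p).isEigenvalue _ ⟨p, _⟩
  · intro p c hc
    rw [← (hμ p).exhausts ⟨p, hUV p (V.mem_nhd p)⟩ c hc]
    -- The fibre over `c` is a translate of the fibre of `μ p`, so it has the same cardinality.
    exact ((Equiv.addRight (σ p ⟨p, V.mem_nhd p⟩)).injective.encard_image _).symm.trans
      (congrArg Set.encard (Equiv.image_eq_preimage_symm _ _)) |>.trans (by simp)
  · exact fun n p => (hμ p).monotone _ (by omega)

end SpectralFlowClass

end SpecFlow

theorem mainTheorem3 {H : Type*} [NormedAddCommGroup H] [InnerProductSpace ℂ H] [CompleteSpace H]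
    [TopologicalSpace.SeparableSpace H] {X : Type*} [TopologicalSpace X]
    (hX : SpecFlow.IsCompactSimplicialComplex X) (D : X → SpecFlow.FRsa H)
    (hD : SpecFlow.IsContinuousFamily D) :
    (∀ a : SpecFlow.CechH1 X, SpecFlow.IsSpectralFlow D a ↔ a = SpecFlow.spectralFlow D) ∧
    ((∃ μ : ℤ → X → ℝ, SpecFlow.IsSpectralExhaustion D μ) ↔ SpecFlow.spectralFlow D = 0) := by
  refine ⟨hD.isSpectralFlow_iff, ?_⟩
  rw [eq_comm, ← hD.isSpectralFlow_iff]
  exact ⟨fun ⟨_, h⟩ => h.isSpectralFlow_zero, fun h => h.exists_isSpectralExhaustion⟩
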